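/- Let $K$ be a field of characteristic $0$, let $n\in\mathbb N$, and let $A_n(K)$ be the Weyl algebra, i.e. the $K$-algebra of differential operators on $K[x_1,\dots,x_n]$ generated by the multiplications by $x_1,\dots,x_n$ and the partial differentiations $\partial_1,\dots,\partial_n$. For $r,s\in\mathbb Z$ let $W_{rs}\subseteq A_n(K)$ be the $K$-linear span of all monomials $x^\alpha\partial^\beta=x_1^{\alpha_1}\cdots x_n^{\alpha_n}\partial_1^{\beta_1}\cdots\partial_n^{\beta_n}$ ($\alpha,\beta\in\mathbb N^n$) of $x$-order $|\alpha|=\alpha_1+\dots+\alpha_n\le r$ and $\partial$-order $|\beta|=\beta_1+\dots+\beta_n\le s$ (so $W_{rs}=0$ if $r<0$ or $s<0$). Let $M$ be a left $A_n(K)$-module generated by finitely many elements $f_1,\dots,f_m$, and let $M_{rs}=\sum_{i=1}^m W_{rs}f_i$ for $r,s\in\mathbb Z$. Call a polynomial $\varphi\in\mathbb Q[t_1,t_2]$ numerical if $\varphi(r,s)\in\mathbb Z$ for all sufficiently large integers $r,s$ (that is, for all integers $r\ge r_0$, $s\ge s_0$, for some $r_0,s_0\in\mathbb Z$), and write $\binom{t}{k}=\frac{t(t-1)\cdots(t-k+1)}{k!}$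 for $k\in\mathbb N$. Then there exists a numerical polynomial $\varphi_M(t_1,t_2)\in\mathbb Q[t_1,t_2]$ such that (i) there are $r_0,s_0\in\mathbb Z$ such that for all integers $r\ge r_0$ and $s\ge s_0$ the $K$-vector space $M_{rs}$ is finite-dimensional and $\varphi_M(r,s)=\dim_K M_{rs}$; (ii) $\deg_{t_1}\varphi_M\le n$ and $\deg_{t_2}\varphi_M\le n$, so that $\deg\varphi_M\le 2n$, and $\varphi_M$ can be represented as $$\varphi_M(t_1,t_2)=\sum_{i=0}^{n}\sum_{j=0}^{n}a_{ij}\binom{t_1+i}{i}\binom{t_2+j}{j}$$ with $a_{ij}\in\mathbb Z$ for all $i,j$. -/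

import Mathlib

noncomputable section

/-- The Weyl algebra `A_n(K)`: the ring of differential operators on `R = K[x_1, …, x_n]`, that is,
the `K`-subalgebra of `End_K(R)` (with composition as product) generated by the operators of
multiplication by `x_1, …, x_n` and the partial differentiations `∂_1, …, ∂_n`. -/
def WeylAlgebra (n : ℕ) (K : Type*) [Field K] :
    Subalgebra K (Module.End K (MvPolynomial (Fin n) K)) :=
  Algebra.adjoin K
    (Set.range (fun i : Fin n => LinearMap.mulLeft K (MvPolynomial.X i : MvPolynomial (Fin n) K)) ∪
      Set.range (fun i : Fin n =>
        ((MvPolynomial.pderiv i : Derivation K (MvPolynomial (Fin n) K) (MvPolynomial (Fin n) K)) :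
          MvPolynomial (Fin n) K →ₗ[K] MvPolynomial (Fin n) K)))

namespace WeylAlgebra

variable {n : ℕ} (K : Type*) [Field K]

/-- The element `x_i` of the Weyl algebra: multiplication by the variable `x_i`. -/
def x (i : Fin n) : WeylAlgebra n K :=
  ⟨LinearMap.mulLeft K (MvPolynomial.X i), Algebra.subset_adjoin (Or.inl ⟨i, rfl⟩)⟩

/-- The element `∂_i` of the Weyl algebra: partial differentiation with respect to `x_i`. -/
def d (i : Fin n) : WeylAlgebra n K :=
  ⟨((MvPolynomial.pderiv i : Derivation K (MvPolynomial (Fin n) K) (MvPolynomial (Fin n) K)) :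
      MvPolynomial (Fin n) K →ₗ[K] MvPolynomial (Fin n) K),
    Algebra.subset_adjoin (Or.inr ⟨i, rfl⟩)⟩

/-- The monomial `x^α ∂^β = x_1^{α_1} ⋯ x_n^{α_n} ∂_1^{β_1} ⋯ ∂_n^{β_n}`. -/
def mono (α β : Fin n → ℕ) : WeylAlgebra n K :=
  (List.ofFn fun i => x K i ^ α i).prod * (List.ofFn fun i => d K i ^ β i).prod

/-- The component `W_{rs}` (`r, s ∈ ℤ`) of the bifiltration of `A_n(K)`: the `K`-span of the
monomials `x^α ∂^β` of `x`-order `|α| ≤ r` and `∂`-order `|β| ≤ s`.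
It is zero if `r < 0` or `s < 0`. -/
def W (n : ℕ) (r s : ℤ) : Submodule K (WeylAlgebra n K) :=
  Submodule.span K
    {D | ∃ α β : Fin n → ℕ, ((∑ i, α i : ℕ) : ℤ) ≤ r ∧ ((∑ i, β i : ℕ) : ℤ) ≤ s ∧ D = mono K α β}

/-- The component `M_{rs} = ∑_i W_{rs} f_i` of the natural bifiltration of an `A_n(K)`-module `M`
associated with the finite family `f_1, …, f_m`. -/
def naturalBifiltration (n : ℕ) {M : Type*} [AddCommGroup M] [Module K M] [Module (WeylAlgebra n K) M]
    [IsScalarTower K (WeylAlgebra n K) M] {m : ℕ} (f : Fin m → M) (r s : ℤ) : Submodule K M :=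
  ⨆ i : Fin m, (W K n r s).map
    ((LinearMap.toSpanSingleton (WeylAlgebra n K) M (f i)).restrictScalars K)

end WeylAlgebra

/-- A polynomial in two variables `t_1` (index `0`) and `t_2` (index `1`) with rational
coefficients is numerical if it takes integer values at all sufficiently large integers. -/
def IsNumericalPolynomial (p : MvPolynomial (Fin 2) ℚ) : Prop :=
  ∃ r₀ s₀ : ℤ, ∀ r s : ℤ, r₀ ≤ r → s₀ ≤ s →
    ∃ z : ℤ, MvPolynomial.eval ![(r : ℚ), (s : ℚ)] p = (z : ℚ)

/-- The binomial coefficient `C(p, k) = p (p - 1) ⋯ (p - k + 1) / k!` of a polynomial `p`. -/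
def binomialPolynomial (p : MvPolynomial (Fin 2) ℚ) (k : ℕ) : MvPolynomial (Fin 2) ℚ :=
  MvPolynomial.C ((k.factorial : ℚ)⁻¹) * ∏ l ∈ Finset.range k, (p - (l : MvPolynomial (Fin 2) ℚ))

end

/-!
The dimension of `M_{rs}` is computed by counting standard monomials, in the style of Gröbner bases
but without ever presenting `M` as a quotient of a free module.

Monomials `x^α ∂^β` with `|α| ≤ r`, `|β| ≤ s` are homogenized: an exponent vector `α` with `|α| ≤ r`
becomes a vector in `ℕ^{n+1}` of total degree exactly `r`, and likewise for `β`. The elements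
`x^α ∂^β f_i` span `M_{rs}`. Fix an order on the indices `(α, β, i)` compatible with addition, and
call an index standard if its element is not a linear combination of the smaller ones of the same
bidegree. A finite ordered spanning family has as many members outside the span of their
predecessors as the dimension of its span (`finrank_span_image_eq_card`), so `dim M_{rs}` is the
number of standard indices of bidegree `(r, s)`.

Multiplication by `x_j` carries monomials to monomials, and `∂_j x^α = x^α ∂_j + α_j x^{α - e_j}`,
where the last term has the same bidegree as the first one once two homogenizing variables are put
in, and is smaller than it. Hence non-standard indices remain non-standard when exponents grow, and
for every `i` the standard exponents form a lower set in `ℕ^{n+1} × ℕ^{n+1}`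
(`WeylAlgebra.isLowerSet_isStandard`).

It remains to count points of bidegree `(r, s)` in a lower set `D`
(`IsLowerSet.card_filter_bidegreeFinset`). By Dickson's lemma the complement of `D` is generated by
finitely many vectors. Removing the cones over them one at a time, the count becomes an integral
combination of counts of cones, and a cone with vertex `(c, d)` has
`C(r - |c| + n, n) * C(s - |d| + n, n)` points once `r ≥ |c|` and `s ≥ |d|`. By Pascal's rule this is
an integral combination of the `C(r + i, i) * C(s + j, j)` with `i, j ≤ n`.
-/

/-! ### Counting exponent vectors in lower sets -/

/-- A function of two natural numbers which, once both are large, is an integral combination of the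
products `C(r + i, i) * C(s + j, j)` with `i, j ≤ n`. -/
def IsEventuallyBinomial (n : ℕ) (H : ℕ → ℕ → ℤ) : Prop :=
  ∃ (a : ℕ → ℕ → ℤ) (N : ℕ), ∀ r s : ℕ, N ≤ r → N ≤ s →
    H r s = ∑ i ∈ Finset.range (n + 1), ∑ j ∈ Finset.range (n + 1),
      a i j * (((r + i).choose i : ℤ) * ((s + j).choose j : ℤ))

namespace IsEventuallyBinomial

variable {n : ℕ} {H H' : ℕ → ℕ → ℤ}

theorem zero (n : ℕ) : IsEventuallyBinomial n fun _ _ => 0 :=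
  ⟨fun _ _ => 0, 0, by simp⟩

theorem add (h : IsEventuallyBinomial n H) (h' : IsEventuallyBinomial n H') :
    IsEventuallyBinomial n fun r s => H r s + H' r s := by
  obtain ⟨a, N, ha⟩ := h
  obtain ⟨a', N', ha'⟩ := h'
  refine ⟨fun i j => a i j + a' i j, max N N', fun r s hr hs => ?_⟩
  beta_reduce
  rw [ha r s (by omega) (by omega), ha' r s (by omega) (by omega)]
  simp only [add_mul, Finset.sum_add_distrib]

theorem sub (h : IsEventuallyBinomial n H) (h' : IsEventuallyBinomial n H') :
    IsEventuallyBinomial n fun r s => H r s - H' r s := by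
  obtain ⟨a, N, ha⟩ := h
  obtain ⟨a', N', ha'⟩ := h'
  refine ⟨fun i j => a i j - a' i j, max N N', fun r s hr hs => ?_⟩
  beta_reduce
  rw [ha r s (by omega) (by omega), ha' r s (by omega) (by omega)]
  simp only [sub_mul, Finset.sum_sub_distrib]

theorem sum {ι : Type*} (t : Finset ι) {H : ι → ℕ → ℕ → ℤ}
    (h : ∀ i, IsEventuallyBinomial n (H i)) :
    IsEventuallyBinomial n fun r s => ∑ i ∈ t, H i r s := by
  classical
  induction t using Finset.induction_on with
  | empty => simpa using zero n
  | insert i t hi ih => simpa only [Finset.sum_insert hi] using (h i).add ih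

end IsEventuallyBinomial

/-- The integral span of the polynomials `C(t + i, i)`, `i ≤ n`, is stable under the shift
`t ↦ t - 1`, because `C(t + n, n) - C(t + n - 1, n - 1) = C(t - 1 + n, n)`. -/
theorem exists_choose_sub_add_eq_sum (n c : ℕ) : ∃ a : ℕ → ℤ, ∀ r : ℕ, c ≤ r →
    ((r - c + n).choose n : ℤ) = ∑ i ∈ Finset.range (n + 1), a i * ((r + i).choose i : ℤ) := by
  induction c generalizing n with
  | zero =>
    refine ⟨fun i => if i = n then 1 else 0, fun r _ => ?_⟩
    simp
  | succ c ih =>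
    cases n with
    | zero => exact ⟨fun _ => 1, by simp⟩
    | succ n =>
      obtain ⟨a, ha⟩ := ih (n + 1)
      obtain ⟨b, hb⟩ := ih n
      refine ⟨fun i => a i - if i < n + 1 then b i else 0, fun r hr => ?_⟩
      have hpascal : (r - c + (n + 1)).choose (n + 1) =
          (r - c + n).choose n + (r - (c + 1) + (n + 1)).choose (n + 1) := by
        rw [show r - (c + 1) + (n + 1) = r - c + n by omega, ← add_assoc,
          Nat.choose_succ_succ]
      have hb' : ∑ i ∈ Finset.range (n + 1 + 1),
          (if i < n + 1 then b i else 0) * ((r + i).choose i : ℤ) =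
          ((r - c + n).choose n : ℤ) := by
        rw [Finset.sum_range_succ, hb r (by omega)]
        simp only [lt_irrefl, if_false, zero_mul, add_zero]
        exact Finset.sum_congr rfl fun i hi => by rw [if_pos (Finset.mem_range.1 hi)]
      simp only [sub_mul, Finset.sum_sub_distrib]
      rw [hb', ← ha r (by omega), hpascal]
      push_cast
      ring

namespace Finset.Nat

theorem card_antidiagonalTuple_succ (n r : ℕ) :
    (antidiagonalTuple (n + 1) r).card = (r + n).choose n := by
  have h : (antidiagonalTuple (n + 1) r).card =
      (Finset.finsuppAntidiag (Finset.univ : Finset (Fin (n + 1))) r).card := by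
    refine Finset.card_equiv Finsupp.equivFunOnFinite.symm fun c => ?_
    simp [mem_antidiagonalTuple]
  rw [h, Finset.card_finsuppAntidiag_nat_eq_choose, Finset.card_univ, Fintype.card_fin,
    show n + 1 + r - 1 = n + r by omega, add_comm r n, Nat.choose_symm_add]

open Classical in
theorem card_filter_le_antidiagonalTuple {n r : ℕ} {g : Fin (n + 1) → ℕ} (h : ∑ i, g i ≤ r) :
    {c ∈ antidiagonalTuple (n + 1) r | g ≤ c}.card = (r - ∑ i, g i + n).choose n := by
  rw [← card_antidiagonalTuple_succ]
  refine (Finset.card_nbij' (· + g) (· - g) ?_ ?_ ?_ ?_).symm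
  · intro c hc
    simp only [mem_coe, mem_antidiagonalTuple, mem_filter, Pi.add_apply,
      Finset.sum_add_distrib] at hc ⊢
    exact ⟨by omega, le_add_self⟩
  · intro c hc
    simp only [mem_coe, mem_antidiagonalTuple, mem_filter, Pi.sub_apply] at hc ⊢
    rw [Finset.sum_tsub_distrib _ fun i _ => hc.2 i, hc.1]
  · intro c _
    simp
  · intro c hc
    simp only [mem_coe, mem_filter] at hc
    exact tsub_add_cancel_of_le hc.2

end Finset.Nat

theorem isUpperSet_of_add_single_mem {ι : Type*} [Fintype ι] [DecidableEq ι]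
    {U : Set ((ι → ℕ) × (ι → ℕ))} (hl : ∀ k, ∀ p ∈ U, p + (Pi.single k 1, 0) ∈ U)
    (hr : ∀ k, ∀ p ∈ U, p + (0, Pi.single k 1) ∈ U) : IsUpperSet U := by
  let S : AddSubmonoid ((ι → ℕ) × (ι → ℕ)) :=
    { carrier := {g | ∀ p ∈ U, p + g ∈ U}
      zero_mem' := fun p hp => by simpa using hp
      add_mem' := fun {g h} hg hh p hp => by simpa [add_assoc] using hh _ (hg p hp) }
  have hS : ∀ g, g ∈ S := by
    intro g
    have hg : g = (∑ k, g.1 k • (Pi.single k 1, 0)) + ∑ k, g.2 k • (0, Pi.single k 1) := by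
      refine Prod.ext ?_ ?_
      · ext k
        simp [Prod.fst_sum, Finset.sum_apply, Pi.single_apply]
      · ext k
        simp [Prod.snd_sum, Finset.sum_apply, Pi.single_apply]
    rw [hg]
    exact add_mem (sum_mem fun k _ => nsmul_mem (S := S) (hl k) _)
      (sum_mem fun k _ => nsmul_mem (S := S) (hr k) _)
  intro p q hpq hp
  have := hS (q - p) p hp
  rwa [add_tsub_cancel_of_le hpq] at this

open Finset.Nat in
/-- Pairs of exponent vectors in `n + 1` variables, of total degrees `r` and `s`. -/
def bidegreeFinset (n r s : ℕ) : Finset ((Fin (n + 1) → ℕ) × (Fin (n + 1) → ℕ)) :=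
  antidiagonalTuple (n + 1) r ×ˢ antidiagonalTuple (n + 1) s

theorem mem_bidegreeFinset {n r s : ℕ} {p : (Fin (n + 1) → ℕ) × (Fin (n + 1) → ℕ)} :
    p ∈ bidegreeFinset n r s ↔ ∑ i, p.1 i = r ∧ ∑ i, p.2 i = s := by
  simp [bidegreeFinset, Finset.Nat.mem_antidiagonalTuple]

open Classical in
theorem card_filter_ge_bidegreeFinset {n : ℕ} (g : (Fin (n + 1) → ℕ) × (Fin (n + 1) → ℕ)) :
    IsEventuallyBinomial n fun r s => ({p ∈ bidegreeFinset n r s | g ≤ p}.card : ℤ) := by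
  obtain ⟨a, ha⟩ := exists_choose_sub_add_eq_sum n (∑ i, g.1 i)
  obtain ⟨b, hb⟩ := exists_choose_sub_add_eq_sum n (∑ i, g.2 i)
  refine ⟨fun i j => a i * b j, max (∑ i, g.1 i) (∑ i, g.2 i), fun r s hr hs => ?_⟩
  have : {p ∈ bidegreeFinset n r s | g ≤ p} =
      {c ∈ Finset.Nat.antidiagonalTuple (n + 1) r | g.1 ≤ c} ×ˢ
        {d ∈ Finset.Nat.antidiagonalTuple (n + 1) s | g.2 ≤ d} := by
    ext p
    simp only [bidegreeFinset, Finset.mem_filter, Finset.mem_product, Prod.le_def]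
    tauto
  beta_reduce
  rw [this, Finset.card_product,
    Finset.Nat.card_filter_le_antidiagonalTuple (le_trans (le_max_left _ _) hr),
    Finset.Nat.card_filter_le_antidiagonalTuple (le_trans (le_max_right _ _) hs), Nat.cast_mul,
    ha r (le_trans (le_max_left _ _) hr), hb s (le_trans (le_max_right _ _) hs),
    Finset.sum_mul_sum]
  exact Finset.sum_congr rfl fun i _ => Finset.sum_congr rfl fun j _ => by ring

open Classical in
/-- Inclusion–exclusion, one generator at a time: among the multiples of `g` outside the ideal
generated by `G`, those divisible by `h` are the multiples of `g ⊔ h` outside that ideal. -/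
theorem card_filter_ge_not_ge_bidegreeFinset {n : ℕ}
    (G : Finset ((Fin (n + 1) → ℕ) × (Fin (n + 1) → ℕ)))
    (g : (Fin (n + 1) → ℕ) × (Fin (n + 1) → ℕ)) :
    IsEventuallyBinomial n fun r s =>
      ({p ∈ bidegreeFinset n r s | g ≤ p ∧ ∀ h ∈ G, ¬ h ≤ p}.card : ℤ) := by
  induction G using Finset.induction_on generalizing g with
  | empty => simpa using card_filter_ge_bidegreeFinset g
  | insert h G hG ih =>
    convert (ih g).sub (ih (g ⊔ h)) using 3 with r s
    rw [eq_sub_iff_add_eq]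
    norm_cast
    rw [← Finset.card_union_of_disjoint]
    · congr 1
      ext p
      simp only [Finset.mem_union, Finset.mem_filter, Finset.forall_mem_insert, sup_le_iff]
      tauto
    · rw [Finset.disjoint_filter]
      rintro p - ⟨-, hp⟩ ⟨hp', -⟩
      exact hp h (Finset.mem_insert_self _ _) (sup_le_iff.1 hp').2

open Classical in
/-- The bigraded Hilbert function of a monomial quotient is eventually polynomial: by Dickson's
lemma the complement of a lower set of exponents is generated by finitely many of them. -/
theorem IsLowerSet.card_filter_bidegreeFinset {n : ℕ}
    {D : Set ((Fin (n + 1) → ℕ) × (Fin (n + 1) → ℕ))} (hD : IsLowerSet D) :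
    IsEventuallyBinomial n fun r s => ({p ∈ bidegreeFinset n r s | p ∈ D}.card : ℤ) := by
  have hfin : {g | Minimal (· ∉ D) g}.Finite :=
    WellQuasiOrderedLE.finite_of_isAntichain (setOfPred_minimal_antichain _)
  convert card_filter_ge_not_ge_bidegreeFinset hfin.toFinset 0 using 7 with r s p
  simp only [Set.Finite.mem_toFinset, Set.mem_ofPred_eq]
  constructor
  · exact fun hp => ⟨zero_le, fun h hh hle => hh.prop (hD hle hp)⟩
  · rintro ⟨-, hp⟩
    by_contra hpD
    obtain ⟨g, hg, hmin⟩ := exists_minimal_le_of_wellFoundedLT (· ∉ D) p hpD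
    exact hp g hmin hg

/-! ### Commutation relations in the Weyl algebra -/

/-- Multiplying an ordered product of powers of pairwise commuting elements by one of them
increases the corresponding exponent. -/
theorem List.mul_prod_ofFn_pow {A : Type*} [Monoid A] {n : ℕ} {y : Fin n → A}
    (hy : ∀ i j, Commute (y i) (y j)) (a : Fin n → ℕ) (j : Fin n) :
    y j * (List.ofFn fun i => y i ^ a i).prod =
      (List.ofFn fun i => y i ^ (a + Pi.single j 1 : Fin n → ℕ) i).prod := by
  induction n with
  | zero => exact j.elim0
  | succ n ih =>
    simp only [List.ofFn_succ, List.prod_cons]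
    cases j using Fin.cases with
    | zero =>
      rw [← mul_assoc, ← pow_succ']
      simp
    | succ j =>
      rw [← mul_assoc, ((hy j.succ 0).pow_right _).eq, mul_assoc,
        ih (y := fun i => y i.succ) (fun i k => hy _ _) (fun i => a i.succ) j]
      simp [Pi.single_apply]

namespace WeylAlgebra

variable {n : ℕ} {K : Type*} [Field K]

theorem commute_x (i j : Fin n) : Commute (x K i) (x K j) := by
  refine Subtype.ext (LinearMap.ext fun p => ?_)
  simp [x, mul_left_comm]

theorem commute_d (i j : Fin n) : Commute (d K i) (d K j) := by
  refine Subtype.ext (LinearMap.ext fun p => ?_)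
  have h : ⁅(MvPolynomial.pderiv i : Derivation K (MvPolynomial (Fin n) K) _),
      MvPolynomial.pderiv j⁆ = 0 :=
    MvPolynomial.derivation_ext fun k => by
      rw [Derivation.commutator_apply, MvPolynomial.pderiv_X, MvPolynomial.pderiv_X,
        Pi.single_apply, Pi.single_apply]
      split_ifs <;> simp
  have h' := DFunLike.congr_fun h p
  rw [Derivation.commutator_apply, Derivation.zero_apply, sub_eq_zero] at h'
  exact h'

theorem x_mul_mono (j : Fin n) (α β : Fin n → ℕ) :
    x K j * mono K α β = mono K (α + Pi.single j 1) β := by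
  rw [mono, mono, ← mul_assoc, List.mul_prod_ofFn_pow commute_x]

theorem coe_d_apply (j : Fin n) (p : MvPolynomial (Fin n) K) :
    (d K j : Module.End K (MvPolynomial (Fin n) K)) p = MvPolynomial.pderiv j p :=
  rfl

theorem coe_prod_x (α : Fin n → ℕ) :
    (((List.ofFn fun i => x K i ^ α i).prod : WeylAlgebra n K) :
      Module.End K (MvPolynomial (Fin n) K)) =
      LinearMap.mulLeft K (MvPolynomial.monomial (Finsupp.equivFunOnFinite.symm α) 1) := by
  have h : (MvPolynomial.monomial (Finsupp.equivFunOnFinite.symm α) 1 :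
      MvPolynomial (Fin n) K) = (List.ofFn fun i => MvPolynomial.X i ^ α i).prod := by
    rw [MvPolynomial.monomial_eq, List.prod_ofFn, Finsupp.prod_fintype _ _ (by simp)]
    simp
  change (WeylAlgebra n K).val _ = Algebra.lmul K (MvPolynomial (Fin n) K) _
  rw [h, map_list_prod, map_list_prod, List.map_ofFn, List.map_ofFn]
  congr 2
  ext1 i
  simp only [Function.comp_apply, map_pow]
  rfl

/-- The Leibniz rule `∂_j x^α = x^α ∂_j + α_j x^{α - e_j}`. -/
theorem d_mul_prod_x (j : Fin n) (α : Fin n → ℕ) :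
    d K j * (List.ofFn fun i => x K i ^ α i).prod =
      (List.ofFn fun i => x K i ^ α i).prod * d K j +
        (α j : K) • (List.ofFn fun i => x K i ^ (α - Pi.single j 1 : Fin n → ℕ) i).prod := by
  have hα : (Finsupp.equivFunOnFinite.symm α - Finsupp.single j 1 : Fin n →₀ ℕ) =
      Finsupp.equivFunOnFinite.symm (α - Pi.single j 1) := by
    ext i
    simp [Finsupp.single_apply, Pi.single_apply, eq_comm]
  apply Subtype.ext
  rw [Subalgebra.coe_mul, Subalgebra.coe_add, Subalgebra.coe_mul, Subalgebra.coe_smul,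
    coe_prod_x, coe_prod_x]
  refine LinearMap.ext fun p => ?_
  simp only [Module.End.mul_apply, LinearMap.add_apply, LinearMap.smul_apply,
    LinearMap.mulLeft_apply, coe_d_apply]
  rw [MvPolynomial.pderiv_mul, MvPolynomial.pderiv_monomial, hα, add_comm, ← smul_mul_assoc,
    MvPolynomial.smul_monomial]
  simp

theorem d_mul_mono (j : Fin n) (α β : Fin n → ℕ) :
    d K j * mono K α β = mono K α (β + Pi.single j 1) +
      (α j : K) • mono K (α - Pi.single j 1) β := by
  rw [mono, mono, mono, ← mul_assoc, d_mul_prod_x, add_mul, mul_assoc,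
    List.mul_prod_ofFn_pow commute_d, smul_mul_assoc]

end WeylAlgebra

/-! ### Dimension of a span by an ordered family -/

open Classical in
/-- The dimension of the span of a finite family is the number of members that do not lie in the
span of the preceding ones. -/
theorem finrank_span_image_eq_card {K V ι L : Type*} [DivisionRing K] [AddCommGroup V] [Module K V]
    [LinearOrder L] {k : ι → L} (hk : Function.Injective k) (v : ι → V) (S : Finset ι) :
    Module.finrank K (Submodule.span K (v '' S)) =
      {x ∈ S | v x ∉ Submodule.span K (v '' {y | y ∈ S ∧ k y < k x})}.card := by
  induction S using Finset.induction_on_max_value k with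
  | empty =>
    rw [Finset.coe_empty, Set.image_empty, Submodule.span_empty, finrank_bot, Finset.filter_empty,
      Finset.card_empty]
  | insert a S ha hmax ih =>
    have hlt : ∀ y ∈ S, k y < k a := fun y hy =>
      lt_of_le_of_ne (hmax y hy) fun h => ha (hk h ▸ hy)
    have h1 : {y | y ∈ insert a S ∧ k y < k a} = (S : Set ι) := by
      ext y
      simp only [Finset.mem_insert, Set.mem_ofPred_eq, Finset.mem_coe]
      exact ⟨fun h => h.1.resolve_left fun e => (e ▸ h.2).false, fun h => ⟨Or.inr h, hlt y h⟩⟩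
    have h2 : ∀ x ∈ S, {y | y ∈ insert a S ∧ k y < k x} = {y | y ∈ S ∧ k y < k x} := by
      intro x hx
      ext y
      simp only [Finset.mem_insert, Set.mem_ofPred_eq]
      exact ⟨fun h => ⟨h.1.resolve_left fun e => ((e ▸ h.2).trans (hlt x hx)).false, h.2⟩,
        fun h => ⟨Or.inr h.1, h.2⟩⟩
    have h3 : {x ∈ S | v x ∉ Submodule.span K (v '' {y | y ∈ insert a S ∧ k y < k x})} =
        {x ∈ S | v x ∉ Submodule.span K (v '' {y | y ∈ S ∧ k y < k x})} :=
      Finset.filter_congr fun x hx => by rw [h2 x hx]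
    rw [Finset.filter_insert, h1, h3, Finset.coe_insert, Set.image_insert_eq,
      Submodule.span_insert]
    split_ifs with hv
    · rw [sup_eq_right.2 (by simpa using hv), ih]
    · rw [Finset.card_insert_of_notMem (by simp [ha]), ← ih, sup_comm]
      have : FiniteDimensional K (Submodule.span K (v '' S)) :=
        FiniteDimensional.span_of_finite K (S.finite_toSet.image v)
      have h := Submodule.finrank_sup_add_finrank_inf_eq (Submodule.span K (v '' S))
        (Submodule.span K {v a})
      rwa [(Submodule.disjoint_span_singleton_of_notMem hv).eq_bot, finrank_bot, add_zero,
        finrank_span_singleton (fun h0 => hv (by simp [h0]))] at h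

/-! ### Standard monomials -/

namespace WeylAlgebra

/-- Indices of the bihomogenized monomials of the free module of rank `m`: a pair of exponent
vectors in `n + 1` variables, the last one homogenizing, together with a basis vector. -/
abbrev MonomialIndex (n m : ℕ) : Type :=
  ((Fin (n + 1) → ℕ) × (Fin (n + 1) → ℕ)) × Fin m

namespace MonomialIndex

variable {n m : ℕ}

/-- The sort key of the monomial order: compare the `∂`-exponents lexicographically, then the
`x`-exponents, then the basis vectors. The `∂`-exponents come first, so that the correction term in
`∂_j x^α ∂^β = x^α ∂^{β + e_j} + α_j x^{α - e_j} ∂^β` is smaller than the leading one. -/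
def key (p : MonomialIndex n m) :
    Lex (Lex (Fin (n + 1) → ℕ) × Lex (Lex (Fin (n + 1) → ℕ) × Fin m)) :=
  toLex (toLex p.1.2, toLex (toLex p.1.1, p.2))

theorem key_injective : Function.Injective (key : MonomialIndex n m → _) := by
  rintro ⟨⟨c, d⟩, i⟩ ⟨⟨c', d'⟩, i'⟩ h
  simp only [key, toLex_inj, Prod.mk.injEq] at h
  obtain ⟨rfl, rfl, rfl⟩ := h
  rfl

theorem key_lt_key {p q : MonomialIndex n m} : key p < key q ↔
    toLex p.1.2 < toLex q.1.2 ∨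
      p.1.2 = q.1.2 ∧ (toLex p.1.1 < toLex q.1.1 ∨ p.1.1 = q.1.1 ∧ p.2 < q.2) := by
  simp [key, Prod.Lex.toLex_lt_toLex]

theorem key_add_lt_key_add {p q : MonomialIndex n m} (h : key p < key q)
    (g : (Fin (n + 1) → ℕ) × (Fin (n + 1) → ℕ)) :
    key (p.1 + g, p.2) < key (q.1 + g, q.2) := by
  rw [key_lt_key] at h ⊢
  simpa [toLex_add] using h

/-- The bidegree of `p`. -/
def bidegree (p : MonomialIndex n m) : ℕ × ℕ :=
  (∑ i, p.1.1 i, ∑ i, p.1.2 i)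

theorem bidegree_add (p : MonomialIndex n m) (g : (Fin (n + 1) → ℕ) × (Fin (n + 1) → ℕ)) :
    bidegree (p.1 + g, p.2) = bidegree p + (∑ i, g.1 i, ∑ i, g.2 i) := by
  simp [bidegree, Finset.sum_add_distrib]

/-- The indices of bidegree `(r, s)`. -/
def indexFinset (n m r s : ℕ) : Finset (MonomialIndex n m) :=
  bidegreeFinset n r s ×ˢ Finset.univ

theorem mem_indexFinset {r s : ℕ} {p : MonomialIndex n m} :
    p ∈ indexFinset n m r s ↔ ∑ i, p.1.1 i = r ∧ ∑ i, p.1.2 i = s := by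
  simp [indexFinset, mem_bidegreeFinset]

end MonomialIndex

open MonomialIndex

variable {n m : ℕ} {K M : Type*} [Field K] [AddCommGroup M] [Module K M]
  [Module (WeylAlgebra n K) M]

variable (K) in
/-- The element `x^α ∂^β f_i` of `M` obtained from an index by dropping the homogenizing
exponents. -/
noncomputable def monoSMul (f : Fin m → M) (p : MonomialIndex n m) : M :=
  mono K (fun i => p.1.1 i.castSucc) (fun i => p.1.2 i.castSucc) • f p.2

variable (K) in
/-- The span of the elements `x^α ∂^β f_i` whose index has the bidegree of `p` and precedes `p`. -/
def lowerSpan (f : Fin m → M) (p : MonomialIndex n m) : Submodule K M :=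
  Submodule.span K (monoSMul K f '' {q | bidegree q = bidegree p ∧ key q < key p})

variable (K) in
/-- An index is standard if its element of `M` is not a combination of the preceding ones of the
same bidegree. Thus the standard indices are those which are not leading monomials of relations. -/
def IsStandard (f : Fin m → M) (p : MonomialIndex n m) : Prop :=
  monoSMul K f p ∉ lowerSpan K f p

variable {f : Fin m → M}

theorem monoSMul_mem_lowerSpan {p q : MonomialIndex n m} (h : bidegree q = bidegree p)
    (h' : key q < key p) : monoSMul K f q ∈ lowerSpan K f p :=
  Submodule.subset_span ⟨q, ⟨h, h'⟩, rfl⟩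

theorem lowerSpan_mono {p q : MonomialIndex n m} (h : bidegree q = bidegree p)
    (h' : key q < key p) : lowerSpan K f q ≤ lowerSpan K f p :=
  Submodule.span_mono (Set.image_mono fun _ hx => ⟨hx.1.trans h, hx.2.trans h'⟩)

/-- A linear operator that multiplies every monomial by `g` up to lower terms of the same bidegree
carries non-standard indices to non-standard indices. -/
theorem not_isStandard_add {g : (Fin (n + 1) → ℕ) × (Fin (n + 1) → ℕ)} (L : M →ₗ[K] M)
    (hL : ∀ p : MonomialIndex n m,
      L (monoSMul K f p) - monoSMul K f (p.1 + g, p.2) ∈ lowerSpan K f (p.1 + g, p.2))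
    {p : MonomialIndex n m} (hp : ¬ IsStandard K f p) : ¬ IsStandard K f (p.1 + g, p.2) := by
  rw [IsStandard, not_not] at hp ⊢
  have hle : (lowerSpan K f p).map L ≤ lowerSpan K f (p.1 + g, p.2) := by
    rw [lowerSpan, Submodule.map_span, Submodule.span_le]
    rintro _ ⟨_, ⟨q, ⟨hdeg, hlt⟩, rfl⟩, rfl⟩
    have hdeg' : bidegree (m := m) (q.1 + g, q.2) = bidegree (m := m) (p.1 + g, p.2) := by
      rw [bidegree_add, bidegree_add, hdeg]
    have hlt' := key_add_lt_key_add hlt g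
    have := Submodule.add_mem _ (lowerSpan_mono hdeg' hlt' (hL q))
      (monoSMul_mem_lowerSpan (K := K) (f := f) hdeg' hlt')
    simpa using this
  have := Submodule.sub_mem _ (hle (Submodule.mem_map_of_mem hp)) (hL p)
  simpa using this

variable [IsScalarTower K (WeylAlgebra n K) M]

theorem not_isStandard_add_single_left (k : Fin (n + 1)) {p : MonomialIndex n m}
    (hp : ¬ IsStandard K f p) : ¬ IsStandard K f (p.1 + (Pi.single k 1, 0), p.2) := by
  cases k using Fin.lastCases with
  | last =>
    refine not_isStandard_add LinearMap.id (fun p => ?_) hp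
    simp [monoSMul]
  | cast j =>
    refine not_isStandard_add (Algebra.lsmul K K M (x K j)) (fun p => ?_) hp
    have : (fun i : Fin n => (p.1.1 + Pi.single j.castSucc 1 : Fin (n + 1) → ℕ) i.castSucc) =
        (fun i => p.1.1 i.castSucc) + Pi.single j 1 := by
      ext i
      simp [Pi.single_apply]
    simp only [monoSMul, Algebra.lsmul_coe, smul_smul, x_mul_mono, Prod.fst_add, Prod.snd_add,
      add_zero, this, sub_self, Submodule.zero_mem]

theorem not_isStandard_add_single_right (k : Fin (n + 1)) {p : MonomialIndex n m}
    (hp : ¬ IsStandard K f p) : ¬ IsStandard K f (p.1 + (0, Pi.single k 1), p.2) := by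
  cases k using Fin.lastCases with
  | last =>
    refine not_isStandard_add LinearMap.id (fun p => ?_) hp
    simp [monoSMul]
  | cast j =>
    refine not_isStandard_add (Algebra.lsmul K K M (d K j)) (fun p => ?_) hp
    have : (fun i : Fin n => (p.1.2 + Pi.single j.castSucc 1 : Fin (n + 1) → ℕ) i.castSucc) =
        (fun i => p.1.2 i.castSucc) + Pi.single j 1 := by
      ext i
      simp [Pi.single_apply]
    simp only [monoSMul, Algebra.lsmul_coe, smul_smul, d_mul_mono, Prod.fst_add, Prod.snd_add,
      add_zero, this, add_smul, add_sub_cancel_left]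
    rw [smul_assoc]
    -- The correction term vanishes if the exponent of `x_j` is zero; otherwise it comes from the
    -- index in which both `x_j` and the new `∂_j` are replaced by homogenizing variables.
    rcases Nat.eq_zero_or_pos (p.1.1 j.castSucc) with h0 | hpos
    · simp [h0]
    refine Submodule.smul_mem _ _ ?_
    have hle : Pi.single j.castSucc 1 ≤ p.1.1 := by
      intro i
      by_cases h : i = j.castSucc
      · simpa [h, Nat.one_le_iff_ne_zero] using hpos.ne'
      · simp [h]
    convert monoSMul_mem_lowerSpan (K := K) (f := f) (p := (p.1 + (0, Pi.single j.castSucc 1), p.2))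
      (q := ((p.1.1 - Pi.single j.castSucc 1 + Pi.single (Fin.last n) 1,
        p.1.2 + Pi.single (Fin.last n) 1), p.2)) ?_ ?_ using 1
    · simp only [monoSMul]
      congr 2
      · ext i
        simp [Pi.single_apply]
      · ext i
        simp
    · have := Finset.sum_le_sum fun i (_ : i ∈ Finset.univ) => hle i
      simp only [bidegree, Pi.add_apply, Pi.sub_apply, Finset.sum_add_distrib, Prod.fst_add,
        Prod.snd_add, Pi.zero_apply, add_zero, Finset.sum_tsub_distrib _ fun i _ => hle i]
      simp only [Finset.sum_pi_single', Finset.mem_univ, if_true] at this ⊢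
      rw [Nat.sub_add_cancel this]
    · rw [key_lt_key]
      left
      simp only [Prod.snd_add, toLex_add]
      refine add_lt_add_right (α := Lex (Fin (n + 1) → ℕ)) ?_ _
      refine ⟨j.castSucc, fun i hi => ?_, ?_⟩
      · have := hi.trans (Fin.castSucc_lt_last j)
        simp [hi.ne, this.ne]
      · simp

theorem isLowerSet_isStandard (i : Fin m) :
    IsLowerSet {p : (Fin (n + 1) → ℕ) × (Fin (n + 1) → ℕ) | IsStandard K f (p, i)} := by
  rw [← isUpperSet_compl]
  exact isUpperSet_of_add_single_mem
    (fun k p hp => not_isStandard_add_single_left (f := f) k (p := (p, i)) hp)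
    (fun k p hp => not_isStandard_add_single_right (f := f) k (p := (p, i)) hp)

theorem naturalBifiltration_eq_span (f : Fin m → M) (r s : ℕ) :
    naturalBifiltration K n f r s =
      Submodule.span K (monoSMul (n := n) K f '' indexFinset n m r s) := by
  simp only [naturalBifiltration, W, Submodule.map_span]
  rw [← Submodule.span_iUnion]
  congr 1
  ext v
  simp only [Set.mem_iUnion, Set.mem_image, Finset.mem_coe, mem_indexFinset]
  constructor
  · rintro ⟨i, _, ⟨α, β, hα, hβ, rfl⟩, rfl⟩
    refine ⟨((Fin.snoc α (r - ∑ i, α i), Fin.snoc β (s - ∑ i, β i)), i), ⟨?_, ?_⟩, ?_⟩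
    · simp [Fin.sum_univ_castSucc]
      omega
    · simp [Fin.sum_univ_castSucc]
      omega
    · simp [monoSMul]
  · rintro ⟨⟨⟨c, d⟩, i⟩, ⟨hc, hd⟩, rfl⟩
    refine ⟨i, _, ⟨fun i => c i.castSucc, fun i => d i.castSucc, ?_, ?_, rfl⟩, rfl⟩
    · simp only [Fin.sum_univ_castSucc] at hc
      beta_reduce
      omega
    · simp only [Fin.sum_univ_castSucc] at hd
      beta_reduce
      omega

theorem finite_naturalBifiltration (f : Fin m → M) (r s : ℕ) :
    Module.Finite K (naturalBifiltration K n f r s) := by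
  rw [naturalBifiltration_eq_span]
  exact FiniteDimensional.span_of_finite K ((Finset.finite_toSet _).image _)

open Classical in
theorem finrank_naturalBifiltration (f : Fin m → M) (r s : ℕ) :
    Module.finrank K (naturalBifiltration K n f r s) =
      ∑ i : Fin m, {p ∈ bidegreeFinset n r s | IsStandard K f (p, i)}.card := by
  rw [naturalBifiltration_eq_span, finrank_span_image_eq_card key_injective,
    Finset.card_filter, indexFinset,
    Finset.sum_product_right]
  refine Finset.sum_congr rfl fun i _ => ?_
  rw [Finset.card_filter]
  refine Finset.sum_congr rfl fun p hp => ?_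
  congr 1
  rw [IsStandard, lowerSpan]
  congr 5
  ext q
  rw [mem_bidegreeFinset] at hp
  simp [mem_bidegreeFinset, bidegree, hp.1, hp.2]

theorem isEventuallyBinomial_finrank_naturalBifiltration (f : Fin m → M) :
    IsEventuallyBinomial n fun r s =>
      (Module.finrank K (naturalBifiltration K n f r s) : ℤ) := by
  simp only [finrank_naturalBifiltration, Nat.cast_sum]
  exact IsEventuallyBinomial.sum _ fun i => (isLowerSet_isStandard i).card_filter_bidegreeFinset

end WeylAlgebra

/-! ### Binomial polynomials -/

theorem eval_binomialPolynomial_add {p : MvPolynomial (Fin 2) ℚ} {v : Fin 2 → ℚ} {t : ℕ}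
    (hp : MvPolynomial.eval v p = t) (k : ℕ) :
    MvPolynomial.eval v (binomialPolynomial (p + (k : MvPolynomial (Fin 2) ℚ)) k) =
      ((t + k).choose k : ℚ) := by
  rw [binomialPolynomial, map_mul, MvPolynomial.eval_C, map_prod,
    Nat.cast_choose_eq_descPochhammer_div, descPochhammer_eval_eq_prod_range, div_eq_inv_mul]
  simp [hp]

theorem totalDegree_binomialPolynomial_le {p : MvPolynomial (Fin 2) ℚ} (hp : p.totalDegree ≤ 1)
    (k : ℕ) : (binomialPolynomial p k).totalDegree ≤ k := by
  refine (MvPolynomial.totalDegree_mul _ _).trans ?_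
  rw [MvPolynomial.totalDegree_C, zero_add]
  refine (MvPolynomial.totalDegree_finsetProd _ _).trans ?_
  refine (Finset.sum_le_card_nsmul _ _ 1 fun l _ => ?_).trans (by simp)
  rw [← map_natCast (MvPolynomial.C (σ := Fin 2) (R := ℚ)) l]
  exact (MvPolynomial.totalDegree_sub_C_le _ _).trans hp

theorem degreeOf_binomialPolynomial_le {p : MvPolynomial (Fin 2) ℚ} {e : Fin 2} {b : ℕ}
    (hp : p.degreeOf e ≤ b) (k : ℕ) : (binomialPolynomial p k).degreeOf e ≤ k * b := by
  refine (MvPolynomial.degreeOf_mul_le _ _ _).trans ?_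
  rw [MvPolynomial.degreeOf_C, zero_add]
  refine (MvPolynomial.degreeOf_prod_le _ _ _).trans ?_
  refine (Finset.sum_le_card_nsmul _ _ b fun l _ => ?_).trans (by simp)
  refine (MvPolynomial.degreeOf_sub_le _ _ _).trans ?_
  rw [← map_natCast (MvPolynomial.C (σ := Fin 2) (R := ℚ)) l, MvPolynomial.degreeOf_C]
  simpa using hp

theorem degreeOf_X_add_natCast_le (e e' : Fin 2) (k : ℕ) :
    (MvPolynomial.X e' + (k : MvPolynomial (Fin 2) ℚ)).degreeOf e ≤ if e = e' then 1 else 0 := by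
  refine (MvPolynomial.degreeOf_add_le _ _ _).trans ?_
  rw [← map_natCast (MvPolynomial.C (σ := Fin 2) (R := ℚ)) k, MvPolynomial.degreeOf_C,
    MvPolynomial.degreeOf_X]
  simp

theorem totalDegree_X_add_natCast_le (e : Fin 2) (k : ℕ) :
    (MvPolynomial.X e + (k : MvPolynomial (Fin 2) ℚ)).totalDegree ≤ 1 := by
  refine (MvPolynomial.totalDegree_add _ _).trans ?_
  rw [← map_natCast (MvPolynomial.C (σ := Fin 2) (R := ℚ)) k, MvPolynomial.totalDegree_C,
    MvPolynomial.totalDegree_X]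
  simp

/-- The polynomial with given coefficients in the binomial basis. -/
noncomputable def binomialSum (n : ℕ) (a : ℕ → ℕ → ℤ) : MvPolynomial (Fin 2) ℚ :=
  ∑ i ∈ Finset.range (n + 1), ∑ j ∈ Finset.range (n + 1),
    MvPolynomial.C (a i j : ℚ) *
      (binomialPolynomial (MvPolynomial.X 0 + (i : MvPolynomial (Fin 2) ℚ)) i *
        binomialPolynomial (MvPolynomial.X 1 + (j : MvPolynomial (Fin 2) ℚ)) j)

theorem eval_binomialSum (n : ℕ) (a : ℕ → ℕ → ℤ) (r s : ℕ) :
    MvPolynomial.eval ![(r : ℚ), (s : ℚ)] (binomialSum n a) =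
      ∑ i ∈ Finset.range (n + 1), ∑ j ∈ Finset.range (n + 1),
        (a i j : ℚ) * (((r + i).choose i : ℚ) * ((s + j).choose j : ℚ)) := by
  simp only [binomialSum, map_sum, map_mul, MvPolynomial.eval_C]
  refine Finset.sum_congr rfl fun i _ => Finset.sum_congr rfl fun j _ => ?_
  rw [eval_binomialPolynomial_add (t := r) (by simp),
    eval_binomialPolynomial_add (t := s) (by simp)]

theorem degreeOf_binomialSum_le (n : ℕ) (a : ℕ → ℕ → ℤ) (e : Fin 2) :
    (binomialSum n a).degreeOf e ≤ n := by
  refine (MvPolynomial.degreeOf_sum_le _ _ _).trans (Finset.sup_le fun i hi => ?_)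
  refine (MvPolynomial.degreeOf_sum_le _ _ _).trans (Finset.sup_le fun j hj => ?_)
  refine (MvPolynomial.degreeOf_C_mul_le _ _ _).trans
    ((MvPolynomial.degreeOf_mul_le _ _ _).trans ?_)
  rw [Finset.mem_range] at hi hj
  have h0 := degreeOf_binomialPolynomial_le (degreeOf_X_add_natCast_le e 0 i) i
  have h1 := degreeOf_binomialPolynomial_le (degreeOf_X_add_natCast_le e 1 j) j
  fin_cases e <;> simp at h0 h1 ⊢ <;> omega

theorem totalDegree_binomialSum_le (n : ℕ) (a : ℕ → ℕ → ℤ) :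
    (binomialSum n a).totalDegree ≤ 2 * n := by
  refine MvPolynomial.totalDegree_finsetSum_le fun i hi =>
    MvPolynomial.totalDegree_finsetSum_le fun j hj => ?_
  refine (MvPolynomial.totalDegree_mul _ _).trans ?_
  rw [MvPolynomial.totalDegree_C, zero_add]
  refine (MvPolynomial.totalDegree_mul _ _).trans ?_
  rw [Finset.mem_range] at hi hj
  have h0 := totalDegree_binomialPolynomial_le (totalDegree_X_add_natCast_le 0 i) i
  have h1 := totalDegree_binomialPolynomial_le (totalDegree_X_add_natCast_le 1 j) j
  omega

theorem theorem5p4 {K : Type*} [Field K] [CharZero K] {n : ℕ}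
    {M : Type*} [AddCommGroup M] [Module K M] [Module (WeylAlgebra n K) M]
    [IsScalarTower K (WeylAlgebra n K) M]
    {m : ℕ} (f : Fin m → M)
    (hf : Submodule.span (WeylAlgebra n K) (Set.range f) = ⊤) :
    ∃ φ : MvPolynomial (Fin 2) ℚ,
      IsNumericalPolynomial φ ∧
      (∃ r₀ s₀ : ℤ, ∀ r s : ℤ, r₀ ≤ r → s₀ ≤ s →
        Module.Finite K (WeylAlgebra.naturalBifiltration K n f r s) ∧
        MvPolynomial.eval ![(r : ℚ), (s : ℚ)] φ =
          (Module.finrank K (WeylAlgebra.naturalBifiltration K n f r s) : ℚ)) ∧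
      φ.degreeOf 0 ≤ n ∧ φ.degreeOf 1 ≤ n ∧ φ.totalDegree ≤ 2 * n ∧
      ∃ a : ℕ → ℕ → ℤ,
        φ = ∑ i ∈ Finset.range (n + 1), ∑ j ∈ Finset.range (n + 1),
          MvPolynomial.C (a i j : ℚ) *
            (binomialPolynomial (MvPolynomial.X 0 + (i : MvPolynomial (Fin 2) ℚ)) i *
              binomialPolynomial (MvPolynomial.X 1 + (j : MvPolynomial (Fin 2) ℚ)) j) := by
  obtain ⟨a, N, ha⟩ :=
    WeylAlgebra.isEventuallyBinomial_finrank_naturalBifiltration (n := n) (K := K) f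
  have key : ∀ r s : ℤ, (N : ℤ) ≤ r → (N : ℤ) ≤ s →
      Module.Finite K (WeylAlgebra.naturalBifiltration K n f r s) ∧
      MvPolynomial.eval ![(r : ℚ), (s : ℚ)] (binomialSum n a) =
        (Module.finrank K (WeylAlgebra.naturalBifiltration K n f r s) : ℚ) := by
    intro r s hr hs
    lift r to ℕ using (Int.natCast_nonneg N).trans hr
    lift s to ℕ using (Int.natCast_nonneg N).trans hs
    refine ⟨WeylAlgebra.finite_naturalBifiltration f r s, ?_⟩
    rw [Int.cast_natCast, Int.cast_natCast, eval_binomialSum]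
    exact_mod_cast (ha r s (by exact_mod_cast hr) (by exact_mod_cast hs)).symm
  exact ⟨binomialSum n a,
    ⟨N, N, fun r s hr hs => ⟨_, (key r s hr hs).2.trans (Int.cast_natCast _).symm⟩⟩,
    ⟨N, N, key⟩, degreeOf_binomialSum_le n a 0, degreeOf_binomialSum_le n a 1,
    totalDegree_binomialSum_le n a, a, rfl⟩
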